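/- Let $\Omega\subset\mathbb R^n$ be a bounded Lipschitz polyhedral domain and let $1\le k\le n-1$. Let $H\Lambda^j(\Omega)$ be the space of $L^2$ differential $j$-forms on $\Omega$ whose (distributional) exterior derivative is in $L^2$, let $H_0\Lambda^j(\Omega)$ be the subspace of forms with vanishing boundary trace, and let $\langle\cdot,\cdot\rangle$, $\|\cdot\|$ denote the $L^2$ inner product and norm. Write $H_0\Lambda^-=H_0\Lambda^{k-1}(\Omega)$, $H_0\Lambda=H_0\Lambda^{k}(\Omega)$, and $\mathrm d^-$, $\mathrm d$ for the exterior derivatives on $(k-1)$- and $k$-forms. For a conforming triangulation $\mathcal T_h$ of $\Omega$ by finitely many $n$-simplices let $V_h^-\subset H_0\Lambda^-$ and $V_h\subset H_0\Lambda$ be the spaces of forms whose restriction to each simplex of $\mathcal T_h$ is a polynomial form in $\mathcal P_r\Lambda^{k-1}$ or $\mathcal P_r^-\Lambda^{k-1}$ (for $V_h^-$) and in $\mathcal P_s\Lambda^{k}$ or $\mathcal P_s^-\Lambda^{k}$ (for $V_h$). Here $\mathcal P_r\Lambda^j$ are the $j$-forms with polynomial coefficients of degree at most $r$, and $\mathcal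 P_r^-\Lambda^j=\mathcal P_{r-1}\Lambda^j+\kappa\mathcal H_{r-1}\Lambda^{j+1}$ for $r\ge1$, where $\mathcal H_{r-1}\Lambda^{j+1}$ are the forms with homogeneous coefficients of degree $r-1$ and $(\kappa\omega)_x(v_1,\dots,v_j)=\omega_x(x,v_1,\dots,v_j)$. The two choices are made so that $\mathrm d^-$ maps $V_h^-$ into $V_h$: namely $r\le s+1$ if $V_h$ is built from $\mathcal P_s\Lambda^k$, and $r\le s$ if it is built from $\mathcal P_s^-\Lambda^k$. Let $f\in L^2\Lambda^k(\Omega)$, let $(\sigma,u)\in H_0\Lambda^-\times H_0\Lambda$ satisfy $$\langle\sigma,\tau\rangle-\langle \mathrm d^-\tau,u\rangle=0\quad\forall \tau\in H_0\Lambda^-,\qquad \langle \mathrm d^-\sigma,v\rangle+\langle \mathrm du,\mathrm dv\rangle=\langle f,v\rangle\quad\forall v\in H_0\Lambda,$$ and let $(\sigma_h,u_h)\in V_h^-\times V_h$ satisfy the same equations for all $\tau\in V_h^-$ and $v\in V_h$. Then $$\langle \mathrm d^-(\sigma-\sigma_h),\mathrm d^-\tau_h\rangle=0\qquad\text{for all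 }\tau_h\in V_h^-.$$ Consequently, if $\mathcal T_h$ is a refinement of another conforming triangulation $\mathcal T_H$ of $\Omega$, and $(\sigma_H,u_H)\in V_H^-\times V_H$ is a solution of the discrete equations on $\mathcal T_H$, for the spaces built from the same polynomial families, then $$\|\mathrm d^-(\sigma-\sigma_h)\|^2=\|\mathrm d^-(\sigma-\sigma_H)\|^2-\|\mathrm d^-(\sigma_h-\sigma_H)\|^2 .$$ -/

import Mathlib

open MeasureTheory Set
open scoped NNReal ENNReal Topology

noncomputable section

namespace HodgeFEM

/-- Euclidean space `ℝⁿ`. -/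
abbrev Eucl (n : ℕ) : Type := EuclideanSpace ℝ (Fin n)

/-- Alternating `k`-linear forms on `ℝⁿ`. -/
abbrev AltForm (n k : ℕ) : Type := Eucl n [⋀^Fin k]→L[ℝ] ℝ

variable {n k : ℕ}

/-! ### Domains -/

/-- A bounded Lipschitz domain: near every boundary point, `Ω` is the part of space strictly above
the graph, in some unit direction `ν`, of a Lipschitz function of the component
`y - ⟪ν, y⟫ ν` orthogonal to `ν`. -/
structure IsLipschitzDomain (Ω : Set (Eucl n)) : Prop where
  isOpen : IsOpen Ω
  isConnected : IsConnected Ω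
  isBounded : Bornology.IsBounded Ω
  lipschitz_boundary : ∀ x ∈ frontier Ω, ∃ ν : Eucl n, ‖ν‖ = 1 ∧
    ∃ (g : Eucl n → ℝ) (L : ℝ≥0), LipschitzWith L g ∧
      ∃ U ∈ 𝓝 x, ∀ y ∈ U, y ∈ Ω ↔ g (y - inner ℝ ν y • ν) < inner ℝ ν y

/-! ### Square integrable differential forms -/

/-- The pointwise inner product of two alternating `k`-forms,
`∑ α(e_{i₁}, …, e_{i_k}) β(e_{i₁}, …, e_{i_k})` over all `i₁ < ⋯ < i_k`. -/
def formInner (α β : AltForm n k) : ℝ :=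
  ∑ I : Fin k ↪o Fin n,
    α (fun j => EuclideanSpace.single (I j) (1 : ℝ)) *
      β (fun j => EuclideanSpace.single (I j) (1 : ℝ))

/-- `L²Λᵏ(Ω)`: classes of square integrable `k`-forms on `Ω` up to equality almost everywhere.
Its inner product and norm are `l2Inner` and `l2Norm` below. -/
abbrev L2Form (Ω : Set (Eucl n)) (k : ℕ) : Type :=
  Lp (AltForm n k) 2 (volume.restrict Ω)

/-- The `L²` inner product of `k`-forms on `Ω`. -/
def l2Inner {Ω : Set (Eucl n)} (ω μ : L2Form Ω k) : ℝ :=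
  ∫ x in Ω, formInner (ω x) (μ x)

/-- The `L²` norm of a `k`-form on `Ω`. -/
def l2Norm {Ω : Set (Eucl n)} (ω : L2Form Ω k) : ℝ :=
  Real.sqrt (l2Inner ω ω)

/-! ### The exterior derivative on `HΛᵏ(Ω)` and vanishing traces -/

/-- The wedge product `a ∧ α` of a covector and a `k`-form,
`(a ∧ α)(v₀, …, v_k) = ∑ i, (-1)ⁱ a(v_i) α(v₀, …, v̂_i, …, v_k)`. -/
def covectorWedge (a : Eucl n →L[ℝ] ℝ) (α : AltForm n k) : AltForm n (k + 1) :=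
  ContinuousAlternatingMap.alternatizeUncurryFin (a.smulRight α)

/-- `η = dω` in the sense of distributions on `Ω`: for every smooth `φ` with compact support
in `Ω`, `∫_Ω φ η = - ∫_Ω dφ ∧ ω`. -/
def IsWeakExtDeriv {Ω : Set (Eucl n)} (ω : L2Form Ω k) (η : L2Form Ω (k + 1)) : Prop :=
  ∀ φ : Eucl n → ℝ, ContDiff ℝ (⊤ : ℕ∞) φ → HasCompactSupport φ → tsupport φ ⊆ Ω →
    ∫ x in Ω, φ x • η x = - ∫ x in Ω, covectorWedge (fderiv ℝ φ x) (ω x)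

/-- `HΛᵏ(Ω)`, the square integrable `k`-forms whose exterior derivative is square integrable. -/
def HForm (Ω : Set (Eucl n)) (k : ℕ) : Set (L2Form Ω k) :=
  {ω | ∃ η : L2Form Ω (k + 1), IsWeakExtDeriv ω η}

open Classical in
/-- The exterior derivative `d : HΛᵏ(Ω) → L²Λᵏ⁺¹(Ω)` (given the value `0` outside `HΛᵏ(Ω)`).
On an open set it is uniquely determined, see `extD_eq`. -/
def extD {Ω : Set (Eucl n)} (ω : L2Form Ω k) : L2Form Ω (k + 1) :=
  if h : ∃ η : L2Form Ω (k + 1), IsWeakExtDeriv ω η then h.choose else 0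

/-- The boundary trace of `ω ∈ HΛᵏ(Ω)` as a functional on smooth functions,
`φ ↦ ∫_Ω (φ dω + dφ ∧ ω)`. For `ω` smooth up to the boundary the integrand is `d(φ ω)` and the
value is `∫_{∂Ω} φ ν ∧ ω`, with `ν` the outer conormal; it therefore carries exactly the
tangential part `tr ω` of `ω` on `∂Ω`. -/
def weakTrace {Ω : Set (Eucl n)} (ω : L2Form Ω k) (φ : Eucl n → ℝ) : AltForm n (k + 1) :=
  ∫ x in Ω, (φ x • extD ω x + covectorWedge (fderiv ℝ φ x) (ω x))

/-- `H₀Λᵏ(Ω)`, the forms in `HΛᵏ(Ω)` with vanishing trace on the boundary. -/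
def H0Form (Ω : Set (Eucl n)) (k : ℕ) : Set (L2Form Ω k) :=
  {ω | ω ∈ HForm Ω k ∧
    ∀ φ : Eucl n → ℝ, ContDiff ℝ (⊤ : ℕ∞) φ → HasCompactSupport φ → weakTrace ω φ = 0}

/-! ### Polynomial differential forms -/

/-- The `k`-forms with polynomial coefficients of degree smaller than `r`. For `r ≥ 1` this is
`P_{r-1}Λᵏ`. -/
def PolyFormsLT (n k r : ℕ) : Set (Eucl n → AltForm n k) :=
  {ω | ∀ v : Fin k → Eucl n, ∃ p : MvPolynomial (Fin n) ℝ,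
    (∀ m ∈ p.support, m.degree < r) ∧ ∀ x : Eucl n, ω x v = MvPolynomial.eval (fun i => x i) p}

/-- `P_rΛᵏ`, the `k`-forms with polynomial coefficients of degree at most `r`. -/
def PolyForms (n k r : ℕ) : Set (Eucl n → AltForm n k) :=
  PolyFormsLT n k (r + 1)

/-- The `k`-forms whose coefficients are homogeneous polynomials of degree `r`. -/
def HomPolyForms (n k r : ℕ) : Set (Eucl n → AltForm n k) :=
  {ω | ∀ v : Fin k → Eucl n, ∃ p : MvPolynomial (Fin n) ℝ,
    p.IsHomogeneous r ∧ ∀ x : Eucl n, ω x v = MvPolynomial.eval (fun i => x i) p}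

/-- The Koszul operator, `(κω)_x(v₁, …, v_k) = ω_x(x, v₁, …, v_k)`. -/
def koszul (ω : Eucl n → AltForm n (k + 1)) : Eucl n → AltForm n k :=
  fun x => (ω x).curryLeft x

/-- The incomplete space `P_r⁻Λᵏ = P_{r-1}Λᵏ + κ H_{r-1}Λᵏ⁺¹` for `r ≥ 1`. -/
def TrimmedPolyForms (n k r : ℕ) : Set (Eucl n → AltForm n k) :=
  {ω | ∃ α ∈ PolyFormsLT n k r, ∃ β ∈ HomPolyForms n (k + 1) (r - 1), ω = α + koszul β}

/-- The two kinds of local shape functions: `full r` stands for `P_rΛ`, and `trimmed r` for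
`P_r⁻Λ`. -/
inductive PolyFamily
  | full (r : ℕ)
  | trimmed (r : ℕ)

/-- The polynomial `k`-forms of a family. -/
def PolyFamily.forms (F : PolyFamily) (n k : ℕ) : Set (Eucl n → AltForm n k) :=
  match F with
  | .full r => PolyForms n k r
  | .trimmed r => TrimmedPolyForms n k r

/-- The index `r` of a family. -/
def PolyFamily.index : PolyFamily → ℕ
  | .full r => r
  | .trimmed r => r

/-- The family is `P_r` with `r ≥ 0` or `P_r⁻` with `r ≥ 1`. -/
def PolyFamily.IsValid : PolyFamily → Prop
  | .full _ => True
  | .trimmed r => 1 ≤ r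

/-- The admissible choices of consecutive families: those for which the exterior derivatives of
the forms of the first, which have degree at most `r - 1` where `r` is its index, lie in the
second. They are `P_r → P_s` and `P_r⁻ → P_s` with `r ≤ s + 1`, and `P_r → P_s⁻` and
`P_r⁻ → P_s⁻` with `r ≤ s`. -/
def PolyFamily.IsConsecutive (F G : PolyFamily) : Prop :=
  F.IsValid ∧ G.IsValid ∧
    match G with
    | .full s => F.index ≤ s + 1
    | .trimmed s => F.index ≤ s

/-! ### Triangulations and finite element spaces -/

/-- A (finite, conforming) triangulation of `Ω` into `n`-simplices. -/
structure IsTriangulation (Ω : Set (Eucl n)) (T : Geometry.SimplicialComplex ℝ (Eucl n)) :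
    Prop where
  finite : T.faces.Finite
  pure : ∀ s ∈ T.faces, ∃ t ∈ T.faces, s ⊆ t ∧ t.card = n + 1
  space_eq : T.space = closure Ω

/-- `T` is a refinement of `T'`: every `n`-simplex of `T` is contained in one of `T'`. -/
def IsRefinement (T T' : Geometry.SimplicialComplex ℝ (Eucl n)) : Prop :=
  ∀ s ∈ T.faces, s.card = n + 1 → ∃ t ∈ T'.faces, t.card = n + 1 ∧
    convexHull ℝ (s : Set (Eucl n)) ⊆ convexHull ℝ (t : Set (Eucl n))

/-- The forms in `HΛᵏ(Ω)` whose restriction to each `n`-simplex of `T` is a polynomial form of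
the given family: `P_rΛᵏ(T)` or `P_r⁻Λᵏ(T)`. -/
def PiecewiseForms (Ω : Set (Eucl n)) (T : Geometry.SimplicialComplex ℝ (Eucl n))
    (F : PolyFamily) (k : ℕ) : Set (L2Form Ω k) :=
  {ω | ω ∈ HForm Ω k ∧ ∀ s ∈ T.faces, s.card = n + 1 → ∃ p ∈ F.forms n k,
    ∀ᵐ x ∂(volume.restrict Ω), x ∈ convexHull ℝ (s : Set (Eucl n)) → ω x = p x}

/-- The finite element space `V_hᵏ`. -/
def FEForms (Ω : Set (Eucl n)) (T : Geometry.SimplicialComplex ℝ (Eucl n))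
    (F : PolyFamily) (k : ℕ) : Set (L2Form Ω k) :=
  PiecewiseForms Ω T F k ∩ H0Form Ω k

/-! ### The mixed formulation of the Hodge Laplace equation -/

/-- `(σ, u) ∈ W⁻ × W` solves the mixed formulation posed on `W⁻ × W` with data `f`. -/
structure IsMixedSolution {Ω : Set (Eucl n)} (Wm : Set (L2Form Ω k)) (W : Set (L2Form Ω (k + 1)))
    (f : L2Form Ω (k + 1)) (σ : L2Form Ω k) (u : L2Form Ω (k + 1)) : Prop where
  mem_left : σ ∈ Wm
  mem_right : u ∈ W
  first_eq : ∀ τ ∈ Wm, l2Inner σ τ - l2Inner (extD τ) u = 0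
  second_eq : ∀ v ∈ W, l2Inner (extD σ) v + l2Inner (extD u) (extD v) = l2Inner f v

/-! ### The exterior derivative is well defined -/

theorem IsWeakExtDeriv.unique {Ω : Set (Eucl n)} (hΩ : IsOpen Ω) {ω : L2Form Ω k}
    {η η' : L2Form Ω (k + 1)} (h : IsWeakExtDeriv ω η) (h' : IsWeakExtDeriv ω η') : η = η' := by
  have hl : ∀ ζ : L2Form Ω (k + 1), LocallyIntegrable ζ (volume.restrict Ω) := fun ζ =>
    (Lp.memLp ζ).locallyIntegrable (by norm_num)
  have hint : ∀ (ζ : L2Form Ω (k + 1)) (φ : Eucl n → ℝ), ContDiff ℝ (⊤ : ℕ∞) φ → HasCompactSupport φ →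
      Integrable (fun x => φ x • ζ x) (volume.restrict Ω) := fun ζ φ h1 h2 =>
    (hl ζ).integrable_smul_left_of_hasCompactSupport h1.continuous h2
  have key : ∀ᵐ x ∂(volume : Measure (Eucl n)), x ∈ Ω → (η x - η' x) = 0 := by
    apply hΩ.ae_eq_zero_of_integral_contDiff_smul_eq_zero (f := fun x => η x - η' x)
    · exact locallyIntegrableOn_of_locallyIntegrable_restrict ((hl η).sub (hl η'))
    · intro φ h1 h2 h3
      rw [← setIntegral_eq_integral_of_forall_compl_eq_zero (s := Ω)]
      · simp only [smul_sub]
        rw [integral_sub (hint η φ h1 h2) (hint η' φ h1 h2), h φ h1 h2 h3, h' φ h1 h2 h3, sub_self]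
      · intro x hx
        rw [image_eq_zero_of_notMem_tsupport fun hm => hx (h3 hm), zero_smul]
  apply Lp.ext
  rw [Filter.EventuallyEq, ae_restrict_iff' hΩ.measurableSet]
  filter_upwards [key] with x hx hxΩ
  exact sub_eq_zero.1 (hx hxΩ)

theorem extD_eq {Ω : Set (Eucl n)} (hΩ : IsOpen Ω) {ω : L2Form Ω k} {η : L2Form Ω (k + 1)}
    (h : IsWeakExtDeriv ω η) : extD ω = η := by
  have hex : ∃ η : L2Form Ω (k + 1), IsWeakExtDeriv ω η := ⟨η, h⟩
  rw [extD, dif_pos hex]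
  exact hex.choose_spec.unique hΩ h

end HodgeFEM

end

open HodgeFEM

/-! The form `v = dτ_h` is admissible in the second equation of both the continuous and the discrete
problem, because `d` maps `V_h⁻` into `V_h ⊂ H₀Λ`. Since `d ∘ d = 0`, the term `⟨du, dv⟩` drops out
and both equations reduce to `⟨f, dτ_h⟩`: `⟨dσ, dτ_h⟩ = ⟨f, dτ_h⟩ = ⟨dσ_h, dτ_h⟩`. Subtracting gives
the orthogonality. Under refinement `V_H⁻ ⊂ V_h⁻`, so `τ_h = σ_h - σ_H` is allowed, and the second
claim is the Pythagorean identity.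

The work lies in `extD_mem_FEForms`, the inclusion `d V_h⁻ ⊂ V_h`, which has three ingredients.
First, `d ∘ d = 0` weakly and `d` preserves vanishing traces; both come from
`integral_tensor_eq_zero`, that is, from testing with the partial derivatives of `φ` and using the
symmetry of its Hessian. Secondly, inside a simplex the weak derivative is the classical one
(`IsWeakExtDeriv.ae_eq_extDeriv`). Thirdly, `d` lowers the polynomial degree by one, which the index
conditions on the two families match (`PolyFamily.IsConsecutive.extDeriv_mem_forms`). -/

open MeasureTheory Set
open scoped NNReal ENNReal Topology

noncomputable section

namespace HodgeFEM

variable {n k : ℕ} {Ω : Set (Eucl n)}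

/-! ### Finite dimensionality of the alternating forms -/

/-- The coefficients of an alternating form in the standard basis, indexed by all tuples. -/
def coeffMap (n k : ℕ) : AltForm n k →ₗ[ℝ] ((Fin k → Fin n) → ℝ) where
  toFun α J := α fun j => EuclideanSpace.single (J j) (1 : ℝ)
  map_add' _ _ := rfl
  map_smul' _ _ := rfl

theorem coeffMap_injective (n k : ℕ) : Function.Injective (coeffMap n k) := by
  intro α β h
  apply ContinuousAlternatingMap.toAlternatingMap_injective
  apply AlternatingMap.coe_multilinearMap_injective
  refine Module.Basis.ext_multilinear (fun _ => (EuclideanSpace.basisFun (Fin n) ℝ).toBasis) ?_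
  intro J
  simpa [coeffMap] using congrFun h J

instance : FiniteDimensional ℝ (AltForm n k) :=
  FiniteDimensional.of_injective _ (coeffMap_injective n k)

/-- A linear left inverse of the injective coefficient map recovers the form from finitely many
scalar coefficients, and it is continuous by finite dimensionality. -/
theorem contDiff_of_apply {m : ℕ∞} {ω : Eucl n → AltForm n k}
    (h : ∀ v, ContDiff ℝ m fun x => ω x v) : ContDiff ℝ m ω := by
  obtain ⟨g, hg⟩ := (coeffMap n k).exists_leftInverse_of_injective
    (LinearMap.ker_eq_bot.2 (coeffMap_injective n k))
  have : ω = fun x => g.toContinuousLinearMap (coeffMap n k (ω x)) := by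
    ext1 x
    exact (LinearMap.congr_fun hg (ω x)).symm
  rw [this]
  exact g.toContinuousLinearMap.contDiff.comp (contDiff_pi.2 fun J => h _)

/-! ### Polynomial functions -/

/-- The functions on `ℝⁿ` given by polynomials of degree smaller than `r`. -/
def polyFnLT (n r : ℕ) : Submodule ℝ (Eucl n → ℝ) :=
  (MvPolynomial.restrictSupport ℝ {m : Fin n →₀ ℕ | m.degree < r}).map
    (LinearMap.pi fun x : Eucl n => (MvPolynomial.aeval fun i => x i).toLinearMap)

theorem mem_polyFnLT {r : ℕ} {f : Eucl n → ℝ} :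
    f ∈ polyFnLT n r ↔ ∃ p : MvPolynomial (Fin n) ℝ, (∀ m ∈ p.support, m.degree < r) ∧
      ∀ x : Eucl n, f x = MvPolynomial.eval (fun i => x i) p := by
  simp only [polyFnLT, Submodule.mem_map, MvPolynomial.mem_restrictSupport_iff, funext_iff]
  refine exists_congr fun p => and_congr Iff.rfl (forall_congr' fun x => ?_)
  simp [MvPolynomial.aeval_eq_eval, eq_comm]

theorem mem_polyFormsLT {r : ℕ} {ω : Eucl n → AltForm n k} :
    ω ∈ PolyFormsLT n k r ↔ ∀ v, (fun x => ω x v) ∈ polyFnLT n r := by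
  simp only [mem_polyFnLT]; rfl

theorem polyFnLT_mono {r s : ℕ} (h : r ≤ s) : polyFnLT n r ≤ polyFnLT n s :=
  Submodule.map_mono (MvPolynomial.restrictSupport_mono ℝ fun _ hm => lt_of_lt_of_le hm h)

theorem polyFormsLT_mono {r s : ℕ} (h : r ≤ s) : PolyFormsLT n k r ⊆ PolyFormsLT n k s :=
  fun _ hω => mem_polyFormsLT.2 fun v => polyFnLT_mono h (mem_polyFormsLT.1 hω v)

theorem hasFDerivAt_eval (p : MvPolynomial (Fin n) ℝ) (x : Eucl n) :
    HasFDerivAt (fun y : Eucl n => MvPolynomial.eval (fun i => y i) p)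
      (∑ i, MvPolynomial.eval (fun i => x i) (MvPolynomial.pderiv i p) •
        (EuclideanSpace.proj i : Eucl n →L[ℝ] ℝ)) x := by
  induction p using MvPolynomial.induction_on with
  | C a => simpa using hasFDerivAt_const a x
  | add p q hp hq =>
    simpa [add_smul, Finset.sum_add_distrib] using hp.fun_add hq
  | mul_X p i hp =>
    have h := hp.mul (EuclideanSpace.proj i : Eucl n →L[ℝ] ℝ).hasFDerivAt
    refine (h.congr_fderiv ?_).congr_of_eventuallyEq (Filter.Eventually.of_forall fun y => ?_)
    · ext v
      simp [MvPolynomial.pderiv_X, Pi.single_apply, Finset.sum_add_distrib, add_mul,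
        Finset.mul_sum, apply_ite]
      exact Finset.sum_congr rfl fun j _ => by ring
    · simp

theorem contDiff_of_mem_polyFnLT {r : ℕ} {f : Eucl n → ℝ} (hf : f ∈ polyFnLT n r) {m : ℕ∞} :
    ContDiff ℝ m f := by
  obtain ⟨p, -, hp⟩ := mem_polyFnLT.1 hf
  rw [funext hp]
  clear hp
  induction p using MvPolynomial.induction_on with
  | C a => simpa using contDiff_const
  | add p q hp hq => simpa using hp.add hq
  | mul_X p i hp => simpa using hp.mul (EuclideanSpace.proj i : Eucl n →L[ℝ] ℝ).contDiff

theorem pderiv_degree_lt {r : ℕ} {p : MvPolynomial (Fin n) ℝ}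
    (hp : ∀ m ∈ p.support, m.degree < r + 1) (i : Fin n) :
    ∀ m ∈ (MvPolynomial.pderiv i p).support, m.degree < r := by
  intro m hm
  rw [MvPolynomial.mem_support_iff, MvPolynomial.coeff_pderiv] at hm
  have := hp (m + Finsupp.single i 1) (MvPolynomial.mem_support_iff.2 (left_ne_zero_of_mul hm))
  simpa using this

theorem fderiv_mem_polyFnLT {r : ℕ} {f : Eucl n → ℝ} (hf : f ∈ polyFnLT n (r + 1))
    (v : Eucl n) : (fun x => fderiv ℝ f x v) ∈ polyFnLT n r := by
  obtain ⟨p, hp, hfp⟩ := mem_polyFnLT.1 hf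
  have : (fun x => fderiv ℝ f x v) = ∑ i, v i • fun x : Eucl n =>
      MvPolynomial.eval (fun i => x i) (MvPolynomial.pderiv i p) := by
    ext x
    rw [funext hfp, (hasFDerivAt_eval p x).fderiv]
    simp [mul_comm]
  rw [this]
  exact Submodule.sum_mem _ fun i _ => Submodule.smul_mem _ _
    (mem_polyFnLT.2 ⟨_, pderiv_degree_lt hp i, fun _ => rfl⟩)

theorem coord_mul_mem_polyFnLT {r : ℕ} {f : Eucl n → ℝ} (hf : f ∈ polyFnLT n r) (i : Fin n) :
    (fun x => x i * f x) ∈ polyFnLT n (r + 1) := by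
  obtain ⟨p, hp, hfp⟩ := mem_polyFnLT.1 hf
  refine mem_polyFnLT.2 ⟨MvPolynomial.X i * p, fun m hm => ?_, fun x => by simp [hfp]⟩
  rw [MvPolynomial.support_X_mul, Finset.mem_map] at hm
  obtain ⟨m', hm', rfl⟩ := hm
  have := hp m' hm'
  simp
  omega

theorem extDeriv_mem_polyFormsLT {r : ℕ} {ω : Eucl n → AltForm n k}
    (hω : ω ∈ PolyFormsLT n k (r + 1)) : extDeriv ω ∈ PolyFormsLT n (k + 1) r := by
  rw [mem_polyFormsLT] at hω ⊢
  intro v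
  have hd : ∀ x, DifferentiableAt ℝ ω x := fun x =>
    (contDiff_of_apply (m := 1) fun v => contDiff_of_mem_polyFnLT (hω v)).differentiable
      (by simp) x
  simp only [fun x => extDeriv_apply (hd x) v]
  rw [← Finset.sum_fn]
  exact Submodule.sum_mem _ fun i _ => Submodule.smul_of_tower_mem _ ((-1) ^ i.val)
    (fderiv_mem_polyFnLT (hω (i.removeNth v)) (v i))

theorem koszul_mem_polyFormsLT {r : ℕ} {β : Eucl n → AltForm n (k + 1)}
    (hβ : β ∈ PolyFormsLT n (k + 1) r) : koszul β ∈ PolyFormsLT n k (r + 1) := by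
  rw [mem_polyFormsLT] at hβ ⊢
  intro v
  -- Only the inserted slot is expanded, as `x = ∑ xᵢ eᵢ`, so each term is a coordinate times a
  -- coefficient of `β`.
  have : (fun x => koszul β x v) = ∑ i, fun x : Eucl n =>
      x i * β x (Matrix.vecCons (EuclideanSpace.single i (1 : ℝ)) v) := by
    ext x
    have hx := (EuclideanSpace.basisFun (Fin n) ℝ).sum_repr x
    have := congrArg (fun y => (β x).curryLeft y v) hx
    simp only [map_sum, map_smul] at this
    simp only [EuclideanSpace.basisFun_repr, EuclideanSpace.basisFun_apply] at this
    simpa [koszul] using this.symm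
  rw [this]
  exact Submodule.sum_mem _ fun i _ => coord_mul_mem_polyFnLT (hβ _) i

theorem homPolyForms_subset {r : ℕ} : HomPolyForms n k r ⊆ PolyFormsLT n k (r + 1) := by
  intro ω hω v
  obtain ⟨p, hp, h⟩ := hω v
  refine ⟨p, fun m hm => ?_, h⟩
  have := hp (MvPolynomial.mem_support_iff.1 hm)
  rw [Finsupp.degree_eq_weight_one]
  exact Nat.lt_succ_of_le this.le

theorem zero_mem_homPolyForms {r : ℕ} : 0 ∈ HomPolyForms n k r :=
  fun _ => ⟨0, MvPolynomial.isHomogeneous_zero _ _ _, by simp⟩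

theorem add_mem_polyFormsLT {r : ℕ} {ω η : Eucl n → AltForm n k} (hω : ω ∈ PolyFormsLT n k r)
    (hη : η ∈ PolyFormsLT n k r) : ω + η ∈ PolyFormsLT n k r := by
  rw [mem_polyFormsLT] at *
  exact fun v => Submodule.add_mem _ (hω v) (hη v)

theorem sub_mem_polyFormsLT {r : ℕ} {ω η : Eucl n → AltForm n k} (hω : ω ∈ PolyFormsLT n k r)
    (hη : η ∈ PolyFormsLT n k r) : ω - η ∈ PolyFormsLT n k r := by
  rw [mem_polyFormsLT] at *
  exact fun v => Submodule.sub_mem _ (hω v) (hη v)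

theorem sub_mem_homPolyForms {r : ℕ} {ω η : Eucl n → AltForm n k} (hω : ω ∈ HomPolyForms n k r)
    (hη : η ∈ HomPolyForms n k r) : ω - η ∈ HomPolyForms n k r := by
  intro v
  obtain ⟨p, hp, h⟩ := hω v
  obtain ⟨q, hq, h'⟩ := hη v
  exact ⟨p - q, hp.sub hq, fun x => by simp [h, h']⟩

theorem PolyFamily.sub_mem_forms (F : PolyFamily) {ω η : Eucl n → AltForm n k}
    (hω : ω ∈ F.forms n k) (hη : η ∈ F.forms n k) : ω - η ∈ F.forms n k := by
  cases F with
  | full r => exact sub_mem_polyFormsLT hω hη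
  | trimmed r =>
    obtain ⟨α, hα, β, hβ, rfl⟩ := hω
    obtain ⟨α', hα', β', hβ', rfl⟩ := hη
    refine ⟨α - α', sub_mem_polyFormsLT hα hα', β - β', sub_mem_homPolyForms hβ hβ', ?_⟩
    ext x v
    simp [koszul]
    ring

theorem PolyFamily.IsValid.forms_subset {F : PolyFamily} (hF : F.IsValid) :
    F.forms n k ⊆ PolyFormsLT n k (F.index + 1) := by
  cases F with
  | full r => exact Subset.rfl
  | trimmed r =>
    rintro _ ⟨α, hα, β, hβ, rfl⟩
    -- Validity is essential: for `r = 0` truncated subtraction would let `κ` act on constant forms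
    -- and produce degree 1.
    have hr : r - 1 + 1 = r := Nat.sub_add_cancel hF
    have := koszul_mem_polyFormsLT (homPolyForms_subset hβ)
    rw [hr] at this
    exact add_mem_polyFormsLT (polyFormsLT_mono (Nat.le_succ r) hα) this

theorem PolyFamily.contDiff_of_mem_forms {F : PolyFamily} (hF : F.IsValid)
    {p : Eucl n → AltForm n k} (hp : p ∈ F.forms n k) {m : ℕ∞} : ContDiff ℝ m p :=
  contDiff_of_apply fun v => contDiff_of_mem_polyFnLT (mem_polyFormsLT.1 (hF.forms_subset hp) v)

/-- Differentiation turns degree at most the index into degree below it. For a trimmed target the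
result already lies in the summand `P_{s-1}Λ`, so the Koszul part can be zero. -/
theorem PolyFamily.IsConsecutive.extDeriv_mem_forms {Fm F : PolyFamily}
    (h : Fm.IsConsecutive F) {p : Eucl n → AltForm n k} (hp : p ∈ Fm.forms n k) :
    extDeriv p ∈ F.forms n (k + 1) := by
  obtain ⟨hm, -, hle⟩ := h
  have hd := extDeriv_mem_polyFormsLT (hm.forms_subset hp)
  cases F with
  | full s => exact polyFormsLT_mono hle hd
  | trimmed s =>
    refine ⟨_, polyFormsLT_mono hle hd, 0, zero_mem_homPolyForms, ?_⟩
    ext x v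
    simp [koszul]

open ContinuousAlternatingMap (alternatizeUncurryFin alternatizeUncurryFinCLM)

section General

variable {E V W Z : Type*} [NormedAddCommGroup E] [NormedSpace ℝ E]
  [NormedAddCommGroup V] [NormedSpace ℝ V] [NormedAddCommGroup W] [NormedSpace ℝ W]
  [NormedAddCommGroup Z] [NormedSpace ℝ Z]

/-! ### Integration by parts -/

theorem integrable_bilin_of_hasCompactSupport {X : Type*} [TopologicalSpace X]
    [SecondCountableTopology X] [MeasurableSpace X] [OpensMeasurableSpace X] {μ : Measure X}
    (B : V →L[ℝ] W →L[ℝ] Z) {c : X → V} (hc : Continuous c) (hs : HasCompactSupport c)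
    {g : X → W} (hg : Integrable g μ) : Integrable (fun x => B (c x) (g x)) μ := by
  obtain ⟨C, hC⟩ := hs.exists_bound_of_continuous hc
  have hcm : AEStronglyMeasurable c μ :=
    (hc.stronglyMeasurable_of_hasCompactSupport hs).aestronglyMeasurable
  refine (hg.norm.const_mul (‖B‖ * C)).mono'
    (B.aestronglyMeasurable_comp₂ hcm hg.aestronglyMeasurable)
    (Filter.Eventually.of_forall fun x => ?_)
  calc ‖B (c x) (g x)‖ ≤ ‖B‖ * ‖c x‖ * ‖g x‖ := B.le_opNorm₂ _ _
    _ ≤ ‖B‖ * C * ‖g x‖ := by gcongr; exact hC x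

/-- The bilinear map `(a, w) ↦ A (a ⊗ w)`. -/
def tensorL (A : (E →L[ℝ] V) →L[ℝ] W) : (E →L[ℝ] ℝ) →L[ℝ] V →L[ℝ] W :=
  (ContinuousLinearMap.compL ℝ V (E →L[ℝ] V) W A) ∘L ContinuousLinearMap.smulRightL ℝ E V

theorem contDiff_fderiv_apply_const {φ : E → ℝ} (h : ContDiff ℝ (⊤ : ℕ∞) φ) (v : E) :
    ContDiff ℝ (⊤ : ℕ∞) fun x => fderiv ℝ φ x v :=
  (h.fderiv_right (m := (⊤ : ℕ∞)) (by simp)).clm_apply contDiff_const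

/-- The bilinear map `(D, w) ↦ (u, v ↦ D(u, v) w)`. -/
def smulRightL₂ (E V : Type*) [NormedAddCommGroup E] [NormedSpace ℝ E] [NormedAddCommGroup V]
    [NormedSpace ℝ V] : (E →L[ℝ] E →L[ℝ] ℝ) →L[ℝ] V →L[ℝ] E →L[ℝ] E →L[ℝ] V :=
  ((ContinuousLinearMap.compL ℝ E (E →L[ℝ] ℝ) (E →L[ℝ] V)) ∘L
    (ContinuousLinearMap.smulRightL ℝ E V).flip).flip

theorem smulRightL₂_apply (D : E →L[ℝ] E →L[ℝ] ℝ) (w : V) (v : E) :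
    smulRightL₂ E V D w v = (D v).smulRight w := rfl

variable [MeasurableSpace E] [BorelSpace E] [FiniteDimensional ℝ E] {μ : Measure E}

set_option maxSynthPendingDepth 3 in
/-- Let `A` and `A'` be such that `A' ∘ A` vanishes on symmetric bilinear maps, as is the case for
alternation. If `η` is the weak derivative `A (∇ω)` when tested with the partial derivatives of
`φ`, then `∫ A' (dφ ⊗ η) = 0`. -/
theorem integral_tensor_eq_zero [CompleteSpace V] [CompleteSpace W] [CompleteSpace Z]
    (A : (E →L[ℝ] V) →L[ℝ] W) (A' : (E →L[ℝ] W) →L[ℝ] Z)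
    (hA : ∀ f : E →L[ℝ] E →L[ℝ] V, (∀ u v, f u v = f v u) → A' (A ∘L f) = 0)
    {ω : E → V} {η : E → W} (hω : Integrable ω μ) (hη : Integrable η μ)
    {φ : E → ℝ} (h : ContDiff ℝ (⊤ : ℕ∞) φ) (hs : HasCompactSupport φ)
    (H : ∀ v, ∫ x, fderiv ℝ φ x v • η x ∂μ =
      -∫ x, A ((fderiv ℝ (fun y => fderiv ℝ φ y v) x).smulRight (ω x)) ∂μ) :
    ∫ x, A' ((fderiv ℝ φ x).smulRight (η x)) ∂μ = 0 := by
  have h' : ContDiff ℝ (⊤ : ℕ∞) (fderiv ℝ φ) := h.fderiv_right (by simp)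
  have hsymm : ∀ x v w, fderiv ℝ (fderiv ℝ φ) x v w = fderiv ℝ (fderiv ℝ φ) x w v := fun x =>
    (h.contDiffAt.isSymmSndFDerivAt (by simp; norm_cast))
  -- Differentiating `∂_v φ` puts `v` in the second slot of the Hessian; symmetry moves it to the
  -- first.
  have hD : ∀ x v, fderiv ℝ (fun y => fderiv ℝ φ y v) x = fderiv ℝ (fderiv ℝ φ) x v := by
    intro x v
    ext w
    rw [fderiv_clm_apply ((h'.differentiable (by simp)) x) (differentiableAt_const _)]
    simp [hsymm x v w]
  have hB : Integrable (fun x => (fderiv ℝ φ x).smulRight (η x)) μ :=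
    integrable_bilin_of_hasCompactSupport (ContinuousLinearMap.smulRightL ℝ E W)
      h'.continuous (hs.fderiv ℝ) hη
  have hC : Integrable (fun x => smulRightL₂ E V (fderiv ℝ (fderiv ℝ φ) x) (ω x)) μ :=
    integrable_bilin_of_hasCompactSupport (smulRightL₂ E V)
      (h'.continuous_fderiv (by simp)) ((hs.fderiv ℝ).fderiv ℝ) hω
  have hCv : ∀ v, Integrable (fun x => (fderiv ℝ (fderiv ℝ φ) x v).smulRight (ω x)) μ := fun v =>
    hC.apply_continuousLinearMap v
  -- Evaluated at `v`, this is the hypothesis for the test function `∂_v φ`. It leaves `A' ∘ A`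
  -- applied to the integral of `D²φ ⊗ ω`, which is symmetric.
  have hBC : ∫ x, (fderiv ℝ φ x).smulRight (η x) ∂μ =
      -(A ∘L ∫ x, smulRightL₂ E V (fderiv ℝ (fderiv ℝ φ) x) (ω x) ∂μ) := by
    ext1 v
    rw [ContinuousLinearMap.integral_apply hB]
    simp only [neg_apply, ContinuousLinearMap.comp_apply]
    rw [ContinuousLinearMap.integral_apply hC]
    simp only [smulRightL₂_apply]
    rw [← ContinuousLinearMap.integral_comp_comm _ (hCv v)]
    have hv := H v
    simp only [hD] at hv
    exact hv
  rw [ContinuousLinearMap.integral_comp_comm _ hB, hBC, map_neg, neg_eq_zero]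
  refine hA _ fun u v => ?_
  simp only [ContinuousLinearMap.integral_apply hC, smulRightL₂_apply,
    ContinuousLinearMap.integral_apply (hCv _)]
  simp [hsymm _ u v]

/-- Scalar integration by parts in each direction `v` gives the identity for the full derivative;
the constant map `A` then commutes with the integrals. -/
theorem integral_smul_map_fderiv [CompleteSpace V] [CompleteSpace W] [μ.IsAddHaarMeasure]
    (A : (E →L[ℝ] V) →L[ℝ] W) {ω : E → V} (hω : ContDiff ℝ 1 ω) {φ : E → ℝ}
    (h : ContDiff ℝ (⊤ : ℕ∞) φ) (hs : HasCompactSupport φ) :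
    ∫ x, φ x • A (fderiv ℝ ω x) ∂μ = -∫ x, A ((fderiv ℝ φ x).smulRight (ω x)) ∂μ := by
  have hω' : Continuous (fderiv ℝ ω) := hω.continuous_fderiv (by simp)
  have hφ' : Continuous (fderiv ℝ φ) := h.continuous_fderiv (by simp)
  have h1 : Integrable (fun x => φ x • fderiv ℝ ω x) μ :=
    (h.continuous.smul hω').integrable_of_hasCompactSupport hs.smul_right
  have h2 : Integrable (fun x => (fderiv ℝ φ x).smulRight (ω x)) μ := by
    refine Continuous.integrable_of_hasCompactSupport ?_ ?_
    · exact ((ContinuousLinearMap.smulRightL ℝ E V).continuous.comp hφ').clm_apply hω.continuous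
    · refine (hs.fderiv ℝ).mono fun x hx hx' => hx ?_
      ext v
      simp [hx']
  have h3 : Integrable (fun x => φ x • ω x) μ :=
    (h.continuous.smul hω.continuous).integrable_of_hasCompactSupport hs.smul_right
  have key : ∫ x, φ x • fderiv ℝ ω x ∂μ = -∫ x, (fderiv ℝ φ x).smulRight (ω x) ∂μ := by
    ext1 v
    rw [ContinuousLinearMap.integral_apply h1, neg_apply,
      ContinuousLinearMap.integral_apply h2]
    exact integral_smul_fderiv_eq_neg_fderiv_smul_of_integrable
      (h2.apply_continuousLinearMap v) (h1.apply_continuousLinearMap v) h3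
      (fun x _ => h.differentiable (by simp) x) (fun x _ => hω.differentiable (by simp) x)
  have e1 := A.integral_comp_comm h1
  have e2 := A.integral_comp_comm h2
  rw [key, map_neg, ← e2] at e1
  simpa only [map_smul] using e1

end General

/-! ### Wedge products and exterior derivatives -/

/-- The bilinear map `(a, α) ↦ a ∧ α`. -/
def wedgeL (n k : ℕ) : (Eucl n →L[ℝ] ℝ) →L[ℝ] AltForm n k →L[ℝ] AltForm n (k + 1) :=
  tensorL (alternatizeUncurryFinCLM ℝ (Eucl n) ℝ)

theorem wedgeL_apply (a : Eucl n →L[ℝ] ℝ) (α : AltForm n k) :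
    wedgeL n k a α = covectorWedge a α := rfl

/-- If `η` is the exterior derivative of `ω` when tested with the partial derivatives of `φ`, then
`∫ dφ ∧ η = 0`. -/
theorem integral_wedge_eq_zero {μ : Measure (Eucl n)} {ω : Eucl n → AltForm n k}
    {η : Eucl n → AltForm n (k + 1)} (hω : Integrable ω μ) (hη : Integrable η μ)
    {φ : Eucl n → ℝ} (h : ContDiff ℝ (⊤ : ℕ∞) φ) (hs : HasCompactSupport φ)
    (H : ∀ v, ∫ x, fderiv ℝ φ x v • η x ∂μ =
      -∫ x, covectorWedge (fderiv ℝ (fun y => fderiv ℝ φ y v) x) (ω x) ∂μ) :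
    ∫ x, covectorWedge (fderiv ℝ φ x) (η x) ∂μ = 0 :=
  integral_tensor_eq_zero (alternatizeUncurryFinCLM ℝ (Eucl n) ℝ)
    (alternatizeUncurryFinCLM ℝ (Eucl n) ℝ)
    (fun _ => ContinuousAlternatingMap.alternatizeUncurryFin_alternatizeUncurryFinCLM_comp_of_symmetric)
    hω hη h hs H

theorem continuous_extDeriv {ω : Eucl n → AltForm n k} (hω : ContDiff ℝ 1 ω) :
    Continuous (extDeriv ω) :=
  (alternatizeUncurryFinCLM ℝ (Eucl n) ℝ).continuous.comp (hω.continuous_fderiv (by simp))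

theorem integral_smul_extDeriv {ω : Eucl n → AltForm n k} (hω : ContDiff ℝ 1 ω) {φ : Eucl n → ℝ}
    (h : ContDiff ℝ (⊤ : ℕ∞) φ) (hs : HasCompactSupport φ) :
    ∫ x, φ x • extDeriv ω x = -∫ x, covectorWedge (fderiv ℝ φ x) (ω x) :=
  integral_smul_map_fderiv (alternatizeUncurryFinCLM ℝ (Eucl n) ℝ) hω h hs

theorem integrable_smul_of_hasCompactSupport {μ : Measure (Eucl n)} {φ : Eucl n → ℝ}
    (h : Continuous φ) (hs : HasCompactSupport φ) {ω : Eucl n → AltForm n k}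
    (hω : Integrable ω μ) : Integrable (fun x => φ x • ω x) μ :=
  integrable_bilin_of_hasCompactSupport (ContinuousLinearMap.lsmul ℝ ℝ) h hs hω

theorem integrable_wedge_of_hasCompactSupport {μ : Measure (Eucl n)} {φ : Eucl n → ℝ}
    (h : ContDiff ℝ (⊤ : ℕ∞) φ) (hs : HasCompactSupport φ) {ω : Eucl n → AltForm n k}
    (hω : Integrable ω μ) : Integrable (fun x => covectorWedge (fderiv ℝ φ x) (ω x)) μ :=
  integrable_bilin_of_hasCompactSupport (wedgeL n k) (h.continuous_fderiv (by simp))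
    (hs.fderiv ℝ) hω

theorem HForm.isWeakExtDeriv_extD {ω : L2Form Ω k} (h : ω ∈ HForm Ω k) :
    IsWeakExtDeriv ω (extD ω) := by
  have h' : ∃ η : L2Form Ω (k + 1), IsWeakExtDeriv ω η := h
  rw [extD, dif_pos h']
  exact h'.choose_spec

theorem setIntegral_smul_zero (φ : Eucl n → ℝ) :
    ∫ x in Ω, φ x • (0 : L2Form Ω k) x = 0 := by
  rw [integral_eq_zero_of_ae]
  filter_upwards [Lp.coeFn_zero (AltForm n k) 2 (volume.restrict Ω)] with x hx
  rw [hx]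
  exact smul_zero _

/-- A fine simplex inherits the polynomial of the coarse simplex containing it; regularity and trace
conditions do not see the mesh. -/
theorem FEForms_subset_of_isRefinement {T T' : Geometry.SimplicialComplex ℝ (Eucl n)}
    (h : IsRefinement T T') (F : PolyFamily) : FEForms Ω T' F k ⊆ FEForms Ω T F k := by
  refine fun ω hω => ⟨⟨hω.1.1, fun s hs hcard => ?_⟩, hω.2⟩
  obtain ⟨t, ht, htcard, hst⟩ := h s hs hcard
  obtain ⟨p, hp, hpω⟩ := hω.1.2 t ht htcard
  exact ⟨p, hp, hpω.mono fun x hx hxs => hx (hst hxs)⟩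

/-! ### The complex property `d ∘ d = 0`, with and without boundary conditions -/

section Domain

variable [IsFiniteMeasure (volume.restrict Ω)]

theorem L2Form.integrable (ω : L2Form Ω k) : Integrable ω (volume.restrict Ω) :=
  (Lp.memLp ω).integrable (by norm_num)

/-- This is `d ∘ d = 0`: the partial derivatives of a test function supported in `Ω` are again such
test functions. -/
theorem IsWeakExtDeriv.isWeakExtDeriv_zero {ω : L2Form Ω k} {η : L2Form Ω (k + 1)}
    (h : IsWeakExtDeriv ω η) : IsWeakExtDeriv η 0 := by
  intro φ hφ hs hsub
  rw [setIntegral_smul_zero, zero_eq_neg]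
  refine integral_wedge_eq_zero ω.integrable η.integrable hφ hs fun v => ?_
  exact h _ (contDiff_fderiv_apply_const hφ v) (hs.fderiv_apply ℝ v)
    ((tsupport_fderiv_apply_subset ℝ v).trans hsub)

theorem extD_mem_HForm {ω : L2Form Ω k} (h : ω ∈ HForm Ω k) : extD ω ∈ HForm Ω (k + 1) :=
  ⟨0, (HForm.isWeakExtDeriv_extD h).isWeakExtDeriv_zero⟩

theorem extD_extD (hΩ : IsOpen Ω) {ω : L2Form Ω k} (h : ω ∈ HForm Ω k) : extD (extD ω) = 0 :=
  extD_eq hΩ (HForm.isWeakExtDeriv_extD h).isWeakExtDeriv_zero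

theorem weakTrace_eq {ω : L2Form Ω k} {φ : Eucl n → ℝ} (h : ContDiff ℝ (⊤ : ℕ∞) φ)
    (hs : HasCompactSupport φ) : weakTrace ω φ =
      (∫ x in Ω, φ x • extD ω x) + ∫ x in Ω, covectorWedge (fderiv ℝ φ x) (ω x) :=
  integral_add (integrable_smul_of_hasCompactSupport h.continuous hs (L2Form.integrable _))
    (integrable_wedge_of_hasCompactSupport h hs (L2Form.integrable _))

/-- Vanishing trace says that the weak derivative identity also holds for test functions not
vanishing on `∂Ω`. This larger class is closed under partial derivatives too, so the argument for `d
∘ d = 0` applies again. -/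
theorem extD_mem_H0Form (hΩ : IsOpen Ω) {ω : L2Form Ω k} (h : ω ∈ H0Form Ω k) :
    extD ω ∈ H0Form Ω (k + 1) := by
  refine ⟨extD_mem_HForm h.1, fun φ hφ hs => ?_⟩
  rw [weakTrace_eq hφ hs, extD_extD hΩ h.1, setIntegral_smul_zero, zero_add]
  refine integral_wedge_eq_zero ω.integrable (extD ω).integrable hφ hs fun v => ?_
  have hv := contDiff_fderiv_apply_const hφ v
  have := h.2 _ hv (hs.fderiv_apply ℝ v)
  rw [weakTrace_eq hv (hs.fderiv_apply ℝ v)] at this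
  exact eq_neg_of_add_eq_zero_left this

/-! ### Linearity -/

theorem covectorWedge_sub (a : Eucl n →L[ℝ] ℝ) (α β : AltForm n k) :
    covectorWedge a (α - β) = covectorWedge a α - covectorWedge a β :=
  map_sub (wedgeL n k a) α β

theorem setIntegral_smul_sub {φ : Eucl n → ℝ} (h : Continuous φ) (hs : HasCompactSupport φ)
    (ω η : L2Form Ω k) : ∫ x in Ω, φ x • (ω - η : L2Form Ω k) x =
      (∫ x in Ω, φ x • ω x) - ∫ x in Ω, φ x • η x := by
  rw [← integral_sub (integrable_smul_of_hasCompactSupport h hs ω.integrable)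
    (integrable_smul_of_hasCompactSupport h hs η.integrable)]
  refine integral_congr_ae ?_
  filter_upwards [Lp.coeFn_sub ω η] with x hx
  rw [hx, Pi.sub_apply, smul_sub]

theorem setIntegral_wedge_sub {φ : Eucl n → ℝ} (h : ContDiff ℝ (⊤ : ℕ∞) φ)
    (hs : HasCompactSupport φ) (ω η : L2Form Ω k) :
    ∫ x in Ω, covectorWedge (fderiv ℝ φ x) ((ω - η : L2Form Ω k) x) =
      (∫ x in Ω, covectorWedge (fderiv ℝ φ x) (ω x)) -
        ∫ x in Ω, covectorWedge (fderiv ℝ φ x) (η x) := by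
  rw [← integral_sub (integrable_wedge_of_hasCompactSupport h hs ω.integrable)
    (integrable_wedge_of_hasCompactSupport h hs η.integrable)]
  refine integral_congr_ae ?_
  filter_upwards [Lp.coeFn_sub ω η] with x hx
  rw [hx, Pi.sub_apply, covectorWedge_sub]

theorem IsWeakExtDeriv.sub {ω ω' : L2Form Ω k} {η η' : L2Form Ω (k + 1)}
    (h : IsWeakExtDeriv ω η) (h' : IsWeakExtDeriv ω' η') : IsWeakExtDeriv (ω - ω') (η - η') := by
  intro φ hφ hs hsub
  rw [setIntegral_smul_sub hφ.continuous hs, setIntegral_wedge_sub hφ hs, h φ hφ hs hsub,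
    h' φ hφ hs hsub]
  abel

theorem extD_sub (hΩ : IsOpen Ω) {ω η : L2Form Ω k} (hω : ω ∈ HForm Ω k) (hη : η ∈ HForm Ω k) :
    extD (ω - η) = extD ω - extD η :=
  extD_eq hΩ ((HForm.isWeakExtDeriv_extD hω).sub (HForm.isWeakExtDeriv_extD hη))

theorem sub_mem_HForm {ω η : L2Form Ω k} (hω : ω ∈ HForm Ω k) (hη : η ∈ HForm Ω k) :
    ω - η ∈ HForm Ω k :=
  ⟨_, (HForm.isWeakExtDeriv_extD hω).sub (HForm.isWeakExtDeriv_extD hη)⟩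

theorem sub_mem_H0Form (hΩ : IsOpen Ω) {ω η : L2Form Ω k} (hω : ω ∈ H0Form Ω k)
    (hη : η ∈ H0Form Ω k) : ω - η ∈ H0Form Ω k := by
  refine ⟨sub_mem_HForm hω.1 hη.1, fun φ hφ hs => ?_⟩
  have h1 := hω.2 φ hφ hs
  have h2 := hη.2 φ hφ hs
  rw [weakTrace_eq hφ hs] at h1 h2 ⊢
  rw [extD_sub hΩ hω.1 hη.1, setIntegral_smul_sub hφ.continuous hs, setIntegral_wedge_sub hφ hs,
    sub_add_sub_comm, h1, h2, sub_zero]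

theorem sub_mem_FEForms (hΩ : IsOpen Ω) {T : Geometry.SimplicialComplex ℝ (Eucl n)}
    {F : PolyFamily} {ω η : L2Form Ω k} (hω : ω ∈ FEForms Ω T F k) (hη : η ∈ FEForms Ω T F k) :
    ω - η ∈ FEForms Ω T F k := by
  refine ⟨⟨sub_mem_HForm hω.1.1 hη.1.1, fun s hs hcard => ?_⟩, sub_mem_H0Form hΩ hω.2 hη.2⟩
  obtain ⟨p, hp, hpω⟩ := hω.1.2 s hs hcard
  obtain ⟨q, hq, hqη⟩ := hη.1.2 s hs hcard
  refine ⟨p - q, F.sub_mem_forms hp hq, ?_⟩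
  filter_upwards [hpω, hqη, Lp.coeFn_sub ω η] with x h1 h2 h3 hx
  rw [h3, Pi.sub_apply, Pi.sub_apply, h1 hx, h2 hx]

/-! ### The exterior derivative of a piecewise polynomial form -/

/-- On an open set where `ω` agrees with a smooth form, so do the exterior derivatives. -/
theorem IsWeakExtDeriv.ae_eq_extDeriv (hΩ : IsOpen Ω) {ω : L2Form Ω k} {η : L2Form Ω (k + 1)}
    (h : IsWeakExtDeriv ω η) {p : Eucl n → AltForm n k} (hp : ContDiff ℝ (⊤ : ℕ∞) p)
    {U : Set (Eucl n)} (hU : IsOpen U)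
    (hUp : ∀ᵐ x ∂(volume.restrict Ω), x ∈ U → ω x = p x) :
    ∀ᵐ x ∂(volume.restrict Ω), x ∈ U → η x = extDeriv p x := by
  have hdc : Continuous (extDeriv p) :=
    continuous_extDeriv (hp.of_le (by simp))
  have key : ∀ᵐ x ∂(volume : Measure (Eucl n)), x ∈ U ∩ Ω → η x - extDeriv p x = 0 := by
    apply (hU.inter hΩ).ae_eq_zero_of_integral_contDiff_smul_eq_zero
      (f := fun x => η x - extDeriv p x)
    · refine LocallyIntegrableOn.mono_set ?_ inter_subset_right
      exact locallyIntegrableOn_of_locallyIntegrable_restrict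
        (η.integrable.locallyIntegrable.sub hdc.locallyIntegrable)
    · intro φ hφ hs hsub
      have hφΩ : ∀ x ∉ Ω, φ x = 0 := fun x hx =>
        image_eq_zero_of_notMem_tsupport fun hm => hx (hsub hm).2
      have hdφ : ∀ x ∉ U ∩ Ω, fderiv ℝ φ x = 0 := fun x hx =>
        image_eq_zero_of_notMem_tsupport fun hm => hx (hsub (tsupport_fderiv_subset ℝ hm))
      have hi : Integrable (fun x => φ x • extDeriv p x) (volume.restrict Ω) :=
        ((hφ.continuous.smul hdc).integrable_of_hasCompactSupport hs.smul_right).restrict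
      rw [← setIntegral_eq_integral_of_forall_compl_eq_zero (s := Ω)
        fun x hx => by rw [hφΩ x hx, zero_smul]]
      simp only [smul_sub]
      -- The weak identity for `ω` on `Ω` is compared with classical integration by parts for `p` on
      -- all of space. The right-hand sides agree because `dφ` vanishes off `U ∩ Ω`, where `ω` and
      -- `p` may differ.
      rw [integral_sub (integrable_smul_of_hasCompactSupport hφ.continuous hs η.integrable) hi,
        h φ hφ hs (hsub.trans inter_subset_right),
        setIntegral_eq_integral_of_forall_compl_eq_zero (s := Ω) (f := fun x => φ x • extDeriv p x)
          fun x hx => by rw [hφΩ x hx, zero_smul],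
        integral_smul_extDeriv (hp.of_le (by simp)) hφ hs,
        ← setIntegral_eq_integral_of_forall_compl_eq_zero (s := Ω)
          (f := fun x => covectorWedge (fderiv ℝ φ x) (p x)) fun x hx => by
            rw [hdφ x fun h => hx h.2, ← wedgeL_apply, map_zero, zero_apply],
        sub_neg_eq_add, neg_add_eq_zero]
      refine integral_congr_ae ?_
      filter_upwards [hUp] with x hx
      by_cases hxU : x ∈ U
      · simp only [hx hxU]
      · simp only [hdφ x fun h => hxU h.1, ← wedgeL_apply, map_zero,
          zero_apply]
  rw [ae_restrict_iff' hΩ.measurableSet]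
  filter_upwards [key] with x hx hxΩ hxU
  exact sub_eq_zero.1 (hx ⟨hxU, hxΩ⟩)

/-- The frontier of a convex set is null, so results on open simplices extend to closed ones almost
everywhere. -/
theorem ae_mem_interior_of_convex {s : Set (Eucl n)} (hs : Convex ℝ s) :
    ∀ᵐ x ∂(volume : Measure (Eucl n)), x ∈ s → x ∈ interior s := by
  have : ∀ᵐ x ∂(volume : Measure (Eucl n)), x ∉ frontier s :=
    measure_eq_zero_iff_ae_notMem.1 (hs.addHaar_frontier volume)
  filter_upwards [this] with x hx hxs
  by_contra hxi
  exact hx ⟨subset_closure hxs, hxi⟩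

theorem extD_mem_FEForms (hΩ : IsOpen Ω) {T : Geometry.SimplicialComplex ℝ (Eucl n)}
    {Fm F : PolyFamily} (hF : Fm.IsConsecutive F) {τ : L2Form Ω k} (hτ : τ ∈ FEForms Ω T Fm k) :
    extD τ ∈ FEForms Ω T F (k + 1) := by
  refine ⟨⟨extD_mem_HForm hτ.2.1, fun s hs hcard => ?_⟩, extD_mem_H0Form hΩ hτ.2⟩
  obtain ⟨p, hp, hpτ⟩ := hτ.1.2 s hs hcard
  refine ⟨extDeriv p, hF.extDeriv_mem_forms hp, ?_⟩
  have hd := (HForm.isWeakExtDeriv_extD hτ.2.1).ae_eq_extDeriv hΩ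
    (PolyFamily.contDiff_of_mem_forms hF.1 hp) isOpen_interior
    (hpτ.mono fun x hx hxi => hx (interior_subset hxi))
  have hi := ae_restrict_of_ae (s := Ω)
    (ae_mem_interior_of_convex (convex_convexHull ℝ (s : Set (Eucl n))))
  filter_upwards [hd, hi] with x h1 h2 hx
  exact h1 (h2 hx)

end Domain

/-! ### The inner product -/

theorem L2Form.memLp_apply (ω : L2Form Ω k) (v : Fin k → Eucl n) :
    MemLp (fun x => ω x v) 2 (volume.restrict Ω) :=
  (ContinuousAlternatingMap.apply ℝ (Eucl n) ℝ v).comp_memLp' (Lp.memLp ω)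

theorem integrable_formInner (ω η : L2Form Ω k) :
    Integrable (fun x => formInner (ω x) (η x)) (volume.restrict Ω) :=
  integrable_finsetSum _ fun _ _ => (ω.memLp_apply _).integrable_mul (η.memLp_apply _)

theorem formInner_comm (α β : AltForm n k) : formInner α β = formInner β α :=
  Finset.sum_congr rfl fun _ _ => mul_comm _ _

theorem formInner_sub_left (α β γ : AltForm n k) :
    formInner (α - β) γ = formInner α γ - formInner β γ := by
  simp [formInner, sub_mul, Finset.sum_sub_distrib]

theorem formInner_self_nonneg (α : AltForm n k) : 0 ≤ formInner α α :=
  Finset.sum_nonneg fun _ _ => mul_self_nonneg _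

theorem l2Inner_comm (ω η : L2Form Ω k) : l2Inner ω η = l2Inner η ω := by
  simp only [l2Inner, formInner_comm]

theorem l2Inner_sub_left (ω η ζ : L2Form Ω k) :
    l2Inner (ω - η) ζ = l2Inner ω ζ - l2Inner η ζ := by
  rw [l2Inner, l2Inner, l2Inner,
    ← integral_sub (integrable_formInner ω ζ) (integrable_formInner η ζ)]
  refine integral_congr_ae ?_
  filter_upwards [Lp.coeFn_sub ω η] with x hx
  rw [hx, Pi.sub_apply, formInner_sub_left]

theorem l2Inner_sub_right (ω η ζ : L2Form Ω k) :
    l2Inner ω (η - ζ) = l2Inner ω η - l2Inner ω ζ := by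
  rw [l2Inner_comm, l2Inner_sub_left, l2Inner_comm η, l2Inner_comm ζ]

theorem l2Inner_zero_right (ω : L2Form Ω k) : l2Inner ω 0 = 0 := by
  rw [← sub_self ω, l2Inner_sub_right, sub_self]

theorem l2Norm_sq (ω : L2Form Ω k) : l2Norm ω ^ 2 = l2Inner ω ω :=
  Real.sq_sqrt (integral_nonneg fun _ => formInner_self_nonneg _)

/-- The Pythagorean identity for `ω - ζ = (ω - η) + (η - ζ)` with orthogonal summands. -/
theorem l2Norm_sub_sq_of_orthogonal {ω η ζ : L2Form Ω k} (h : l2Inner (ω - η) (η - ζ) = 0) :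
    l2Norm (ω - η) ^ 2 = l2Norm (ω - ζ) ^ 2 - l2Norm (η - ζ) ^ 2 := by
  simp only [l2Norm_sq, l2Inner_sub_left, l2Inner_sub_right, l2Inner_comm η ω, l2Inner_comm ζ ω,
    l2Inner_comm ζ η] at h ⊢
  linarith

end HodgeFEM

end

open HodgeFEM
theorem mainTheorem10 (n k : ℕ) (hk : k + 2 ≤ n)
    (Ω : Set (Eucl n)) (hΩ : IsLipschitzDomain Ω)
    (Fm F : PolyFamily) (hF : Fm.IsConsecutive F)
    (f : L2Form Ω (k + 1))
    (σ : L2Form Ω k) (u : L2Form Ω (k + 1))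
    (hσu : IsMixedSolution (H0Form Ω k) (H0Form Ω (k + 1)) f σ u)
    (Th : Geometry.SimplicialComplex ℝ (Eucl n)) (hTh : IsTriangulation Ω Th)
    (σh : L2Form Ω k) (uh : L2Form Ω (k + 1))
    (hσuh : IsMixedSolution (FEForms Ω Th Fm k) (FEForms Ω Th F (k + 1)) f σh uh) :
    (∀ τh ∈ FEForms Ω Th Fm k, l2Inner (extD (σ - σh)) (extD τh) = 0) ∧
    ∀ TH : Geometry.SimplicialComplex ℝ (Eucl n), IsTriangulation Ω TH → IsRefinement Th TH →
      ∀ (σH : L2Form Ω k) (uH : L2Form Ω (k + 1)),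
        IsMixedSolution (FEForms Ω TH Fm k) (FEForms Ω TH F (k + 1)) f σH uH →
          l2Norm (extD (σ - σh)) ^ 2 =
            l2Norm (extD (σ - σH)) ^ 2 - l2Norm (extD (σh - σH)) ^ 2 := by
  have hO := hΩ.isOpen
  -- Boundedness of `Ω` makes `L²` forms integrable.
  have : IsFiniteMeasure (volume.restrict Ω) :=
    isFiniteMeasure_restrict.2 hΩ.isBounded.measure_lt_top.ne
  have orth : ∀ τh ∈ FEForms Ω Th Fm k, l2Inner (extD (σ - σh)) (extD τh) = 0 := by
    intro τ hτ
    have hd := extD_mem_FEForms hO hF hτ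
    -- Both problems are tested with `v = dτ`, and `d(dτ) = 0` removes the term containing `du` or
    -- `du_h`.
    have h1 := hσu.second_eq _ hd.2
    have h2 := hσuh.second_eq _ hd
    rw [extD_extD hO hτ.2.1, l2Inner_zero_right, add_zero] at h1 h2
    rw [extD_sub hO hσu.mem_left.1 hσuh.mem_left.2.1, l2Inner_sub_left, h1, h2, sub_self]
  refine ⟨orth, fun TH _ href σH uH hH => ?_⟩
  have hσH : σH ∈ FEForms Ω Th Fm k := FEForms_subset_of_isRefinement href Fm hH.mem_left
  have h := orth _ (sub_mem_FEForms hO hσuh.mem_left hσH)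
  rw [extD_sub hO hσu.mem_left.1 hσuh.mem_left.2.1, extD_sub hO hσuh.mem_left.2.1 hσH.2.1] at h
  rw [extD_sub hO hσu.mem_left.1 hσuh.mem_left.2.1, extD_sub hO hσu.mem_left.1 hσH.2.1,
    extD_sub hO hσuh.mem_left.2.1 hσH.2.1]
  exact l2Norm_sub_sq_of_orthogonal h
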